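/- Let $\mathcal C$ be a (skeletally) small preadditive category and let $\mathrm{Mod}(\mathcal C)$ be the category of additive covariant functors $\mathcal C\to\mathbf{Ab}$. A left ideal of $\mathrm{Hom}_{\mathcal C}(C,-)$ is an additive subfunctor $I(C,-)\subseteq \mathrm{Hom}_{\mathcal C}(C,-)$; for $h:C\to B$ let $(I:h)$ be the left ideal of $\mathrm{Hom}_{\mathcal C}(B,-)$ with $(I:h)(X)=\{f:B\to X\mid f\circ h\in I(C,X)\}$. A left Gabriel filter on $\mathcal C$ is a collection $\mathcal F=\{\mathcal F_C\}_{C\in\mathcal C}$, where $\mathcal F_C$ is a nonempty set of left ideals of $\mathrm{Hom}_{\mathcal C}(C,-)$, such that: (1) if $I\in\mathcal F_C$ and $I\subseteq J$, then $J\in\mathcal F_C$; (2) if $I,J\in\mathcal F_C$, then $I\cap J\in\mathcal F_C$; (3) if $I\in\mathcal F_C$ and $h:C\to B$, then $(I:h)\in\mathcal F_B$; (4) if $J\in\mathcal F_C$ and $I$ is a left ideal of $\mathrm{Hom}_{\mathcal C}(C,-)$ with $(I:h)\in\mathcal F_B$ for all $B\in\mathcal C$ and all $h\in J(C,B)$,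 then $I\in\mathcal F_C$. A module $M$ is $\mathcal F$-closed if, for all $C\in\mathcal C$ and $I\in\mathcal F_C$, restriction along $I\hookrightarrow\mathrm{Hom}_{\mathcal C}(C,-)$ is a bijection $\mathrm{Hom}(\mathrm{Hom}_{\mathcal C}(C,-),M)\to\mathrm{Hom}(I,M)$; let $\mathrm{Mod}(\mathcal C,\mathcal F)$ be the full subcategory of $\mathcal F$-closed modules. A Giraud subcategory of $\mathrm{Mod}(\mathcal C)$ is a full subcategory $\mathcal B$ whose inclusion $i:\mathcal B\to\mathrm{Mod}(\mathcal C)$ has a left adjoint $a$ that preserves kernels. Two Giraud subcategories $\mathcal B,\mathcal B'$ are called equivalent if there is an equivalence of categories $e:\mathcal B\to\mathcal B'$ with $i'\circ e\cong i$ (that is, if they have the same closure under isomorphism in $\mathrm{Mod}(\mathcal C)$). Theorem. For every left Gabriel filter $\mathcal F$ on $\mathcal C$, the subcategory $\mathrm{Mod}(\mathcal C,\mathcal F)$ is a Giraud subcategory of $\mathrm{Mod}(\mathcal C)$, and $\mathcal F\mapsto[\mathrm{Mod}(\mathcal C,\mathcal F)]$ is a bijection from the left Gabriel filters on $\mathcal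 C$ onto the equivalence classes of Giraud subcategories of $\mathrm{Mod}(\mathcal C)$. For every Giraud subcategory $\mathcal B$ with reflector $a$, the class $\mathcal T_{\mathcal B}=\{M\mid a(M)=0\}$ is a hereditary torsion class (closed under subobjects, quotients, coproducts and extensions), and the inverse bijection sends the class of $\mathcal B$ to the filter $\mathcal F$ with $$\mathcal F_C=\{I\subseteq\mathrm{Hom}_{\mathcal C}(C,-)\mid \mathrm{Hom}_{\mathcal C}(C,-)/I\in\mathcal T_{\mathcal B}\}\qquad(C\in\mathcal C).$$ -/

import Mathlib

open CategoryTheory CategoryTheory.Limits Opposite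

universe v u

noncomputable section

namespace GabrielLoc

section Modules

variable (C : Type u) [Category.{v} C] [Preadditive C]

/-- The category `Mod(C)` of `C`-modules: additive covariant functors from `C` to abelian groups,
with natural transformations as morphisms. -/
abbrev LMod := C ⥤+ AddCommGrpCat.{v}

variable {C}

/-- The representable module `Hom(X, -)`. -/
abbrev homMod (X : C) : LMod C := AdditiveFunctor.of (preadditiveCoyoneda.obj (op X))

/-- A left ideal of `Hom(X, -)`: an additive subfunctor of it, i.e. a family of subgroups
`I(X, Y) ⊆ Hom(X, Y)` stable under composition with arbitrary morphisms `Y ⟶ Z`. -/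
@[ext]
structure LeftIdeal (X : C) where
  /-- the subgroup `I(X, Y)` of `Hom(X, Y)` -/
  carrier : ∀ Y : C, AddSubgroup (X ⟶ Y)
  comp_mem : ∀ {Y Z : C} {f : X ⟶ Y} (g : Y ⟶ Z), f ∈ carrier Y → f ≫ g ∈ carrier Z

namespace LeftIdeal

variable {X : C}

/-- Left ideals are ordered by inclusion. -/
instance : LE (LeftIdeal X) := ⟨fun I J => ∀ Y, I.carrier Y ≤ J.carrier Y⟩

/-- The intersection of two left ideals. -/
instance : Min (LeftIdeal X) :=
  ⟨fun I J => ⟨fun Y => I.carrier Y ⊓ J.carrier Y,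
    fun g hf => ⟨I.comp_mem g hf.1, J.comp_mem g hf.2⟩⟩⟩

/-- For `h : X ⟶ B`, the left ideal `(I : h)` of `Hom(B, -)`, with
`(I : h)(Y) = {f : B ⟶ Y | f ∘ h ∈ I(X, Y)}`. -/
def colon (I : LeftIdeal X) {B : C} (h : X ⟶ B) : LeftIdeal B where
  carrier Y :=
    { carrier := {f | h ≫ f ∈ I.carrier Y}
      zero_mem' := by simp [(I.carrier Y).zero_mem]
      add_mem' := fun {f g} hf hg => by
        simpa [Preadditive.comp_add] using (I.carrier Y).add_mem hf hg
      neg_mem' := fun {f} hf => by simpa using (I.carrier Y).neg_mem hf }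
  comp_mem := fun g hf => by simpa using I.comp_mem g hf

/-- A left ideal, regarded as a `C`-module. -/
def toMod (I : LeftIdeal X) : LMod C :=
  letI F : C ⥤ AddCommGrpCat.{v} :=
    { obj := fun Y => AddCommGrpCat.of (I.carrier Y)
      map := fun {Y Z} g => AddCommGrpCat.ofHom
        { toFun := fun f => ⟨f.1 ≫ g, I.comp_mem g f.2⟩
          map_zero' := Subtype.ext (by simp)
          map_add' := fun f f' => Subtype.ext (by simp) }
      map_id := fun Y => by exact AddCommGrpCat.ext fun f => Subtype.ext (Category.comp_id f.1)
      map_comp := fun g h => by exact AddCommGrpCat.ext fun f => Subtype.ext (Category.assoc f.1 g h).symm }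
  haveI : F.Additive :=
    ⟨fun {Y Z g h} => by exact AddCommGrpCat.ext fun f => Subtype.ext (Preadditive.comp_add _ _ _ f.1 g h)⟩
  AdditiveFunctor.of F

/-- The inclusion `I ⟶ Hom(X, -)`. -/
def incl (I : LeftIdeal X) : I.toMod ⟶ homMod X where
  hom :=
    { app := fun Y => AddCommGrpCat.ofHom (I.carrier Y).subtype
      naturality := fun _ _ _ => rfl }

/-- The quotient module `Hom(X, -) / I`. -/
def quot (I : LeftIdeal X) : LMod C :=
  letI F : C ⥤ AddCommGrpCat.{v} :=
    { obj := fun Y => AddCommGrpCat.of ((X ⟶ Y) ⧸ I.carrier Y)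
      map := fun {Y Z} g => AddCommGrpCat.ofHom
        (QuotientAddGroup.map (I.carrier Y) (I.carrier Z) (Preadditive.rightComp X g)
          (fun _ hf => I.comp_mem g hf))
      map_id := fun Y => by
        ext f
        exact congrArg _ (Category.comp_id f)
      map_comp := fun g h => by
        ext f
        exact congrArg _ (Category.assoc f g h).symm }
  haveI : F.Additive := ⟨fun {Y Z g h} => by
    ext f
    exact congrArg _ (Preadditive.comp_add _ _ _ f g h)⟩
  AdditiveFunctor.of F

end LeftIdeal

variable (C) in
/-- A left Gabriel filter on `C`: for each object `X` a (nonempty) filter `F_X` of left ideals of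
`Hom(X, -)`, stable under `(- : h)` and satisfying Gabriel's transitivity condition. -/
@[ext]
structure LeftGabrielFilter where
  /-- the family `F_X` of left ideals of `Hom(X, -)` -/
  ideals : ∀ X : C, Set (LeftIdeal X)
  nonempty : ∀ X : C, (ideals X).Nonempty
  up_closed : ∀ {X : C} {I J : LeftIdeal X}, I ∈ ideals X → I ≤ J → J ∈ ideals X
  inter_mem : ∀ {X : C} {I J : LeftIdeal X}, I ∈ ideals X → J ∈ ideals X → I ⊓ J ∈ ideals X
  colon_mem : ∀ {X B : C} {I : LeftIdeal X} (h : X ⟶ B), I ∈ ideals X → I.colon h ∈ ideals B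
  trans_mem : ∀ {X : C} {I J : LeftIdeal X}, J ∈ ideals X →
    (∀ (B : C) (h : X ⟶ B), h ∈ J.carrier B → I.colon h ∈ ideals B) → I ∈ ideals X

/-- The class of `F`-closed modules: `M` such that, for every `I ∈ F_X`, restriction along
`I ⟶ Hom(X, -)` is a bijection `Hom(Hom(X, -), M) → Hom(I, M)`. The associated full subcategory
is `Mod(C, F)`. -/
def LeftGabrielFilter.closedModules (F : LeftGabrielFilter C) : ObjectProperty (LMod C) :=
  fun M => ∀ (X : C) (I : LeftIdeal X), I ∈ F.ideals X →
    Function.Bijective (fun g : homMod X ⟶ M => I.incl ≫ g)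

/-- A hereditary torsion class of modules: closed under quotients, coproducts (over small index
sets), subobjects and extensions. -/
structure IsHereditaryTorsionClass (T : ObjectProperty (LMod C)) : Prop where
  quotients : T.IsClosedUnderQuotients
  coproducts : ∀ J : Type v, T.IsClosedUnderColimitsOfShape (Discrete J)
  subobjects : T.IsClosedUnderSubobjects
  extensions : T.IsClosedUnderExtensions

/-- The family of left ideals attached to a class `T` of modules:
`{I ⊆ Hom(X, -) | Hom(X, -) / I ∈ T}`. -/
def idealsOf (T : ObjectProperty (LMod C)) (X : C) : Set (LeftIdeal X) :=
  {I | T I.quot}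

end Modules

section Giraud

variable {A : Type*} [Category A] [HasZeroMorphisms A]

/-- A full subcategory is a Giraud subcategory if its inclusion has a left adjoint (the reflector)
and the reflector preserves kernels. -/
structure IsGiraud (B : ObjectProperty A) : Prop where
  reflective : B.ι.IsRightAdjoint
  preserves_kernels : ∀ {X Y : A} (f : X ⟶ Y), PreservesLimit (parallelPair f 0) B.ι.leftAdjoint

variable (A) in
/-- Giraud subcategories of `A` (full subcategories, not necessarily closed under
isomorphisms). -/
structure GiraudSubcategory where
  /-- the class of objects -/
  objs : ObjectProperty A
  isGiraud : IsGiraud objs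

/-- The reflector `a` of a Giraud subcategory. -/
def GiraudSubcategory.reflector (B : GiraudSubcategory A) : A ⥤ B.objs.FullSubcategory :=
  haveI := B.isGiraud.reflective
  B.objs.ι.leftAdjoint

/-- The class `{M | a(M) = 0}`. -/
def GiraudSubcategory.torsionClass (B : GiraudSubcategory A) : ObjectProperty A :=
  fun M => IsZero (B.reflector.obj M)

variable (A) in
/-- Two Giraud subcategories are identified if there is an equivalence between them commuting, up
to natural isomorphism, with the inclusions into the ambient category. -/
instance GiraudSubcategory.setoid : Setoid (GiraudSubcategory A) where
  r B B' := ∃ e : B.objs.FullSubcategory ≌ B'.objs.FullSubcategory,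
    Nonempty (e.functor ⋙ B'.objs.ι ≅ B.objs.ι)
  iseqv :=
    { refl := fun _ => ⟨CategoryTheory.Equivalence.refl, ⟨Functor.leftUnitor _⟩⟩
      symm := fun ⟨e, ⟨i⟩⟩ =>
        ⟨e.symm, ⟨Functor.isoWhiskerLeft e.inverse i.symm ≪≫
          (Functor.associator _ _ _).symm ≪≫ Functor.isoWhiskerRight e.counitIso _ ≪≫
          Functor.leftUnitor _⟩⟩
      trans := fun ⟨e, ⟨i⟩⟩ ⟨e', ⟨i'⟩⟩ =>
        ⟨e.trans e', ⟨Functor.associator _ _ _ ≪≫ Functor.isoWhiskerLeft e.functor i' ≪≫ i⟩⟩ }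

end Giraud

end GabrielLoc

end

/-! By Yoneda a map `Hom(X, -) ⟶ M` is an element of `M(X)`. So `M` is closed iff it is torsion-free
(no nonzero element is killed by a member of the filter) and every homomorphism defined on a member
`I` has the form `f ↦ f x` (`closedModules_iff`). An element `x` counts as torsion when `ann x` lies
in the filter.

From filters to subcategories. Maps into a closed module extend uniquely along any local
isomorphism, a map with torsion kernel and cokernel (`IsLocalIso.existsUnique_extension`).
Reflectivity therefore only needs, for each `M`, a local isomorphism to a closed module. The
classical route applies the colimit of `Hom(I, M)` over the filter twice, the first pass being
needed to remove torsion. Here one pass is enough: a germ is a family of functions that is additive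
and natural only modulo torsion on some `I`, and germs are identified when their difference is
torsion on some member (`loc_closed`). Kernels are preserved because a closed submodule of a
torsion-free module is saturated (`exists_preimage_of_conductor_mem`).

From subcategories to filters. The torsion class of `B` consists of the modules with no nonzero map
to an object of `B` (`torsionClass_iff`); it is closed under subobjects because the reflector
preserves monomorphisms. The reflector inverts `I ⟶ Hom(X, -)` for `I` in the resulting filter, so
objects of `B` are closed. Conversely, the unit is a local isomorphism for this filter, hence an
isomorphism at closed modules. Thus `B` and the closed modules have the same isomorphism closure. -/

noncomputable section

namespace GabrielLoc

/-! ### Modules through their elements; annihilators, conductors and cyclic quotients. -/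

section Elements

variable {C : Type u} [Category.{v} C] [Preadditive C]

/-- The action of a morphism of `C` on the elements of a module. -/
def act (M : LMod C) {X Y : C} (f : X ⟶ Y) : M.obj.obj X →+ M.obj.obj Y :=
  (M.obj.map f).hom

/-- The components of a morphism of modules, as additive maps. -/
def appHom {M N : LMod C} (g : M ⟶ N) (X : C) : M.obj.obj X →+ N.obj.obj X :=
  (g.hom.app X).hom

variable {M N P : LMod C} {X Y Z : C}

@[simp]
lemma act_id (x : M.obj.obj X) : act M (𝟙 X) x = x := by simp [act]

lemma act_comp (f : X ⟶ Y) (g : Y ⟶ Z) (x : M.obj.obj X) :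
    act M (f ≫ g) x = act M g (act M f x) := by simp [act]

lemma add_act (f g : X ⟶ Y) (x : M.obj.obj X) : act M (f + g) x = act M f x + act M g x := by
  simp [act]

@[simp]
lemma zero_act (x : M.obj.obj X) : act M (0 : X ⟶ Y) x = 0 := by simp [act]

lemma neg_act (f : X ⟶ Y) (x : M.obj.obj X) : act M (-f) x = -act M f x := by simp [act]

lemma appHom_act (g : M ⟶ N) (f : X ⟶ Y) (x : M.obj.obj X) :
    appHom g Y (act M f x) = act N f (appHom g X x) :=
  ConcreteCategory.congr_hom (g.hom.naturality f) x

@[simp]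
lemma appHom_comp (g : M ⟶ N) (h : N ⟶ P) (x : M.obj.obj X) :
    appHom (g ≫ h) X x = appHom h X (appHom g X x) := rfl

@[simp]
lemma appHom_id (x : M.obj.obj X) : appHom (𝟙 M) X x = x := rfl

@[simp]
lemma appHom_zero (x : M.obj.obj X) : appHom (0 : M ⟶ N) X x = 0 := rfl

lemma hom_ext_elements {g h : M ⟶ N} (H : ∀ X x, appHom g X x = appHom h X x) : g = h := by
  apply ObjectProperty.hom_ext
  ext X x
  exact H X x

/-- Constructor for morphisms of modules. -/
def mkHom (φ : ∀ X, M.obj.obj X →+ N.obj.obj X)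
    (nat : ∀ {X Y : C} (f : X ⟶ Y) (x : M.obj.obj X), φ Y (act M f x) = act N f (φ X x)) :
    M ⟶ N where
  hom :=
    { app := fun X => AddCommGrpCat.ofHom (φ X)
      naturality := fun X Y f => by
        ext x
        exact nat f x }

/-- The morphism `Hom(X, -) ⟶ M` given by an element of `M(X)`. -/
def ofElement (x : M.obj.obj X) : homMod X ⟶ M :=
  mkHom (fun Y => AddMonoidHom.mk' (fun f : X ⟶ Y => act M f x) (fun f g => add_act f g x))
    (fun f g => act_comp (M := M) g f x)

/-- A morphism `X ⟶ Y`, regarded as an element of the module `Hom(X, -)`. -/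
def homElement (f : X ⟶ Y) : (homMod X).obj.obj Y := f

lemma homElement_surjective (y : (homMod X).obj.obj Y) : ∃ f : X ⟶ Y, homElement f = y := ⟨y, rfl⟩

lemma act_homElement (f : X ⟶ Y) (g : Y ⟶ Z) :
    act (homMod X) g (homElement f) = homElement (f ≫ g) := rfl

@[simp]
lemma appHom_ofElement (x : M.obj.obj X) (f : X ⟶ Y) :
    appHom (ofElement x) Y (homElement f) = act M f x := rfl

lemma appHom_homMod (g : homMod X ⟶ M) (f : X ⟶ Y) :
    appHom g Y (homElement f) = act M f (appHom g X (homElement (𝟙 X))) := by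
  rw [← appHom_act, act_homElement, Category.id_comp]

lemma mono_of_injective (g : M ⟶ N) (hg : ∀ X, Function.Injective (appHom g X)) : Mono g where
  right_cancellation a b hab := hom_ext_elements fun X x => hg X (by
    rw [← appHom_comp, ← appHom_comp, hab])

lemma ofElement_appHom (g : M ⟶ N) (x : M.obj.obj X) :
    ofElement (appHom g X x) = ofElement x ≫ g :=
  hom_ext_elements fun _ f => (appHom_act g f x).symm

lemma ofElement_injective : Function.Injective (ofElement (M := M) (X := X)) := fun x y h => by
  rw [← act_id x, ← act_id y, ← appHom_ofElement, ← appHom_ofElement, h]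

lemma injective_of_mono (g : M ⟶ N) [Mono g] (X : C) : Function.Injective (appHom g X) := by
  intro x y h
  apply ofElement_injective
  rw [← cancel_mono g, ← ofElement_appHom, ← ofElement_appHom, h]

lemma isIso_of_bijective (g : M ⟶ N) (hg : ∀ X, Function.Bijective (appHom g X)) : IsIso g := by
  refine ⟨mkHom (fun X => (AddEquiv.ofBijective (appHom g X) (hg X)).symm) ?_, ?_, ?_⟩
  · intro X Y f x
    obtain ⟨x, rfl⟩ := (hg X).2 x
    apply (hg Y).1
    rw [← appHom_act]
    have h1 := (AddEquiv.ofBijective (appHom g X) (hg X)).symm_apply_apply x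
    have h2 := (AddEquiv.ofBijective (appHom g Y) (hg Y)).symm_apply_apply (act M f x)
    simp only [AddEquiv.ofBijective_apply] at h1 h2
    simp only [AddMonoidHom.coe_coe, h2, h1]
  · refine hom_ext_elements fun X x => ?_
    exact (AddEquiv.ofBijective (appHom g X) (hg X)).symm_apply_apply x
  · refine hom_ext_elements fun X x => ?_
    exact (AddEquiv.ofBijective (appHom g X) (hg X)).apply_symm_apply x

lemma bijective_of_isIso (g : M ⟶ N) [IsIso g] (X : C) : Function.Bijective (appHom g X) := by
  refine ⟨injective_of_mono g X, fun y => ⟨appHom (inv g) X y, ?_⟩⟩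
  rw [← appHom_comp, IsIso.inv_hom_id, appHom_id]

/-- The cokernel of a morphism of modules, computed objectwise. -/
def quotRange (g : M ⟶ N) : LMod C :=
  letI F : C ⥤ AddCommGrpCat.{v} :=
    { obj := fun Y => AddCommGrpCat.of (N.obj.obj Y ⧸ (appHom g Y).range)
      map := fun {Y Z} f => AddCommGrpCat.ofHom
        (QuotientAddGroup.map _ _ (act N f) (by
          rintro _ ⟨x, rfl⟩
          exact ⟨act M f x, appHom_act g f x⟩))
      map_id := fun Y => by
        ext x
        exact congrArg _ (act_id x)
      map_comp := fun f h => by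
        ext x
        exact congrArg _ (act_comp f h x) }
  haveI : F.Additive := ⟨fun {Y Z f h} => by
    ext x
    exact congrArg _ (add_act f h x)⟩
  AdditiveFunctor.of F

/-- The projection onto the objectwise cokernel. -/
def quotRangeMk (g : M ⟶ N) : N ⟶ quotRange g :=
  mkHom (fun X => QuotientAddGroup.mk' (appHom g X).range) (fun _ _ => rfl)

lemma quotRangeMk_eq_zero_iff (g : M ⟶ N) (y : N.obj.obj X) :
    appHom (quotRangeMk g) X y = 0 ↔ ∃ x, appHom g X x = y :=
  QuotientAddGroup.eq_zero_iff (N := (appHom g X).range) y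

lemma quotRangeMk_surjective (g : M ⟶ N) (X : C) :
    Function.Surjective (appHom (quotRangeMk g) X) :=
  QuotientAddGroup.mk_surjective

lemma comp_quotRangeMk (g : M ⟶ N) : g ≫ quotRangeMk g = 0 :=
  hom_ext_elements fun _ x => (quotRangeMk_eq_zero_iff g _).2 ⟨x, rfl⟩

namespace LeftIdeal

@[ext]
lemma ext_mem {I J : LeftIdeal X} (h : ∀ Y (f : X ⟶ Y), f ∈ I.carrier Y ↔ f ∈ J.carrier Y) :
    I = J :=
  LeftIdeal.ext (funext fun Y => AddSubgroup.ext (h Y))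

instance : Top (LeftIdeal X) := ⟨⟨fun _ => ⊤, fun _ _ => trivial⟩⟩

@[simp] lemma mem_top (f : X ⟶ Y) : f ∈ (⊤ : LeftIdeal X).carrier Y := trivial

@[simp]
lemma mem_colon {I : LeftIdeal X} {h : X ⟶ Y} {f : Y ⟶ Z} :
    f ∈ (I.colon h).carrier Z ↔ h ≫ f ∈ I.carrier Z := Iff.rfl

/-- The left ideal of those `f` that carry the element `x` of `N` into the image of `g`. -/
def conductor (g : M ⟶ N) (x : N.obj.obj X) : LeftIdeal X where
  carrier Y :=
    { carrier := {f | ∃ m, appHom g Y m = act N f x}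
      zero_mem' := ⟨0, by simp⟩
      add_mem' := by
        rintro f f' ⟨m, hm⟩ ⟨m', hm'⟩
        exact ⟨m + m', by rw [map_add, hm, hm', add_act]⟩
      neg_mem' := by
        rintro f ⟨m, hm⟩
        exact ⟨-m, by rw [map_neg, hm, neg_act]⟩ }
  comp_mem := by
    rintro Y Z f h ⟨m, hm⟩
    exact ⟨act M h m, by rw [appHom_act, hm, act_comp]⟩

lemma mem_conductor {g : M ⟶ N} {x : N.obj.obj X} {f : X ⟶ Y} :
    f ∈ (conductor g x).carrier Y ↔ ∃ m, appHom g Y m = act N f x := Iff.rfl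

/-- The annihilator of an element of a module. -/
def ann (x : M.obj.obj X) : LeftIdeal X where
  carrier Y :=
    { carrier := {f | act M f x = 0}
      zero_mem' := zero_act x
      add_mem' := fun {f g} (hf : _ = 0) (hg : _ = 0) =>
        show act M (f + g) x = 0 by rw [add_act, hf, hg, add_zero]
      neg_mem' := fun {f} (hf : _ = 0) => show act M (-f) x = 0 by rw [neg_act, hf, neg_zero] }
  comp_mem := fun {_ _ f} g (hf : _ = 0) =>
    show act M (f ≫ g) x = 0 by rw [act_comp, hf, map_zero]

@[simp]
lemma mem_ann {x : M.obj.obj X} {f : X ⟶ Y} : f ∈ (ann x).carrier Y ↔ act M f x = 0 := Iff.rfl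

lemma ann_act (x : M.obj.obj X) (h : X ⟶ Y) : ann (act M h x) = (ann x).colon h := by
  ext Z f
  simp [act_comp]

/-- A member of the left ideal `I`, regarded as an element of the module `I`. -/
def element (I : LeftIdeal X) (f : X ⟶ Y) (hf : f ∈ I.carrier Y) : I.toMod.obj.obj Y := ⟨f, hf⟩

lemma element_surjective (I : LeftIdeal X) (y : I.toMod.obj.obj Y) :
    ∃ f hf, I.element f hf = y := ⟨y.1, y.2, rfl⟩

lemma element_add (I : LeftIdeal X) {f g : X ⟶ Y} (hf : f ∈ I.carrier Y) (hg : g ∈ I.carrier Y) :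
    I.element (f + g) (add_mem hf hg) = I.element f hf + I.element g hg := rfl

lemma element_comp (I : LeftIdeal X) {f : X ⟶ Y} (hf : f ∈ I.carrier Y) (g : Y ⟶ Z) :
    I.element (f ≫ g) (I.comp_mem g hf) = act I.toMod g (I.element f hf) := rfl

lemma appHom_incl (I : LeftIdeal X) (f : X ⟶ Y) (hf : f ∈ I.carrier Y) :
    appHom I.incl Y (I.element f hf) = homElement f := rfl

/-- The canonical projection `Hom(X, -) ⟶ Hom(X, -) / I`. -/
def toQuot (I : LeftIdeal X) : homMod X ⟶ I.quot :=
  mkHom (fun Y => QuotientAddGroup.mk' (I.carrier Y)) (fun _ _ => rfl)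

lemma toQuot_surjective (I : LeftIdeal X) (Y : C) : Function.Surjective (appHom I.toQuot Y) :=
  QuotientAddGroup.mk_surjective

lemma appHom_toQuot_eq_zero_iff (I : LeftIdeal X) (f : X ⟶ Y) :
    appHom I.toQuot Y (homElement f) = 0 ↔ f ∈ I.carrier Y :=
  QuotientAddGroup.eq_zero_iff (N := I.carrier Y) f

lemma incl_toQuot (I : LeftIdeal X) : I.incl ≫ I.toQuot = 0 :=
  hom_ext_elements fun _ f => (I.appHom_toQuot_eq_zero_iff _).2 f.2

/-- The morphism `Hom(X, -) / I ⟶ M` given by an element of `M(X)` annihilated by `I`. -/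
def quotDesc (I : LeftIdeal X) (x : M.obj.obj X) (h : I ≤ ann x) : I.quot ⟶ M :=
  mkHom (fun Y => QuotientAddGroup.lift (I.carrier Y) (appHom (ofElement x) Y) (h Y))
    (fun {Y Z} f y => by
      obtain ⟨y, rfl⟩ := I.toQuot_surjective Y y
      exact appHom_act (ofElement x) f y)

@[simp]
lemma toQuot_quotDesc (I : LeftIdeal X) (x : M.obj.obj X) (h : I ≤ ann x) :
    I.toQuot ≫ I.quotDesc x h = ofElement x := rfl

/-- Identifies the cyclic submodule generated by `x`; closure of a class under subobjects thereby
passes from `M` to the quotient by `ann x`. -/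
lemma quotDesc_ann_mono (x : M.obj.obj X) {I : LeftIdeal X} (h : I = ann x) :
    Mono (I.quotDesc x fun Y => (congrArg (carrier · Y) h).le) := by
  subst h
  refine mono_of_injective _ fun Y => ?_
  rw [injective_iff_map_eq_zero]
  intro y hy
  obtain ⟨y, rfl⟩ := (ann x).toQuot_surjective Y y
  obtain ⟨f, rfl⟩ := homElement_surjective y
  rw [appHom_toQuot_eq_zero_iff]
  exact hy

lemma forall_quot_hom_eq_zero_iff (I : LeftIdeal X) :
    (∀ g : I.quot ⟶ M, g = 0) ↔
      ∀ x : M.obj.obj X, (∀ Y, ∀ f ∈ I.carrier Y, act M f x = 0) → x = 0 := by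
  constructor
  · intro H x hx
    apply ofElement_injective
    rw [← toQuot_quotDesc I x hx, H (I.quotDesc x hx), comp_zero]
    exact hom_ext_elements fun Y f => (map_zero (act M f)).symm
  · intro H g
    have hx := H (appHom (I.toQuot ≫ g) X (homElement (𝟙 X))) fun Y f hf => by
      rw [← appHom_homMod, appHom_comp, (I.appHom_toQuot_eq_zero_iff f).2 hf, map_zero]
    refine hom_ext_elements fun Y y => ?_
    obtain ⟨y, rfl⟩ := I.toQuot_surjective Y y
    obtain ⟨f, rfl⟩ := homElement_surjective y
    rw [← appHom_comp, appHom_homMod, hx, map_zero, appHom_zero]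

end LeftIdeal

end Elements

/-! ### Closed modules, torsion and local isomorphisms. -/

section Localization

variable {C : Type u} [Category.{v} C] [Preadditive C] {M N L : LMod C} {X Y Z : C}

open LeftIdeal

/-- A family of functions is a partial homomorphism on `I` if it restricts to a morphism of modules
defined on `I`. -/
structure IsPartialHom (I : LeftIdeal X) (φ : ∀ Y, (X ⟶ Y) → M.obj.obj Y) : Prop where
  map_add : ∀ {Y} {f g : X ⟶ Y}, f ∈ I.carrier Y → g ∈ I.carrier Y → φ Y (f + g) = φ Y f + φ Y g
  map_comp : ∀ {Y Z} {f : X ⟶ Y} (g : Y ⟶ Z), f ∈ I.carrier Y → φ Z (f ≫ g) = act M g (φ Y f)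

/-- The morphism defined on a left ideal by a partial homomorphism. -/
def IsPartialHom.hom {I : LeftIdeal X} {φ : ∀ Y, (X ⟶ Y) → M.obj.obj Y} (h : IsPartialHom I φ) :
    I.toMod ⟶ M :=
  mkHom (fun Y => AddMonoidHom.mk' (fun f : I.carrier Y => φ Y f)
    (fun f g => h.map_add f.2 g.2)) (fun g f => h.map_comp g f.2)

lemma IsPartialHom.appHom_hom {I : LeftIdeal X} {φ : ∀ Y, (X ⟶ Y) → M.obj.obj Y}
    (h : IsPartialHom I φ) {f : X ⟶ Y} (hf : f ∈ I.carrier Y) :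
    appHom h.hom Y (I.element f hf) = φ Y f := rfl

open Classical in
/-- Every morphism defined on a left ideal is a partial homomorphism. -/
lemma exists_isPartialHom {I : LeftIdeal X} (g : I.toMod ⟶ M) :
    ∃ φ : ∀ Y, (X ⟶ Y) → M.obj.obj Y, ∃ h : IsPartialHom I φ, h.hom = g := by
  let φ : ∀ Y, (X ⟶ Y) → M.obj.obj Y := fun Y f =>
    if hf : f ∈ I.carrier Y then appHom g Y (I.element f hf) else 0
  have hφ : ∀ {Y} {f : X ⟶ Y} (hf : f ∈ I.carrier Y), φ Y f = appHom g Y (I.element f hf) :=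
    fun hf => dif_pos hf
  refine ⟨φ, ⟨fun hf hg => ?_, fun h hf => ?_⟩, ?_⟩
  · rw [hφ hf, hφ hg, hφ (add_mem hf hg), element_add, map_add]
  · rw [hφ hf, hφ (I.comp_mem h hf), element_comp, appHom_act]
  · refine hom_ext_elements fun Y y => ?_
    obtain ⟨f, hf, rfl⟩ := I.element_surjective y
    rw [IsPartialHom.appHom_hom, hφ hf]

namespace LeftGabrielFilter

variable (F : LeftGabrielFilter C)

lemma top_mem (X : C) : ⊤ ∈ F.ideals X := by
  obtain ⟨I, hI⟩ := F.nonempty X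
  exact F.up_closed hI fun _ _ _ => trivial

/-- A module is torsion-free if none of its nonzero elements is annihilated by a member of the
filter. -/
def IsTorsionFree (M : LMod C) : Prop :=
  ∀ ⦃X : C⦄ (I : LeftIdeal X), I ∈ F.ideals X → ∀ x : M.obj.obj X,
    (∀ Y, ∀ f ∈ I.carrier Y, act M f x = 0) → x = 0

variable {F} in
lemma IsTorsionFree.eq_of_act_eq (hM : F.IsTorsionFree M) {I : LeftIdeal X} (hI : I ∈ F.ideals X)
    {x y : M.obj.obj X} (h : ∀ Y, ∀ f ∈ I.carrier Y, act M f x = act M f y) : x = y :=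
  sub_eq_zero.1 (hM I hI _ fun Y f hf => by rw [map_sub, h Y f hf, sub_self])

variable {F} in
lemma IsTorsionFree.eq_zero_of_ann_mem (hM : F.IsTorsionFree M) {x : M.obj.obj X}
    (hx : ann x ∈ F.ideals X) : x = 0 :=
  hM _ hx _ fun _ _ hf => hf

lemma closedModules_iff : F.closedModules M ↔ F.IsTorsionFree M ∧
    ∀ ⦃X : C⦄ (I : LeftIdeal X), I ∈ F.ideals X → ∀ φ : ∀ Y, (X ⟶ Y) → M.obj.obj Y,
      IsPartialHom I φ → ∃ x, ∀ Y, ∀ f ∈ I.carrier Y, φ Y f = act M f x := by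
  constructor
  · refine fun H => ⟨fun X I hI x hx => ?_, fun X I hI φ hφ => ?_⟩
    · refine ofElement_injective ((H X I hI).1 (hom_ext_elements fun Y y => ?_))
      obtain ⟨f, hf, rfl⟩ := I.element_surjective y
      change appHom (ofElement x) Y (appHom I.incl Y _) = appHom (ofElement 0) Y (appHom I.incl Y _)
      rw [appHom_incl, appHom_ofElement, appHom_ofElement, hx Y f hf, map_zero]
    · obtain ⟨g, hg⟩ := (H X I hI).2 hφ.hom
      refine ⟨appHom g X (homElement (𝟙 X)), fun Y f hf => ?_⟩
      rw [← hφ.appHom_hom hf, ← hg, ← appHom_homMod, appHom_comp, appHom_incl]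
  · rintro ⟨h₁, h₂⟩ X I hI
    constructor
    · intro g g' (h : I.incl ≫ g = I.incl ≫ g')
      have key : appHom g X (homElement (𝟙 X)) = appHom g' X (homElement (𝟙 X)) := by
        refine h₁.eq_of_act_eq hI fun Y f hf => ?_
        rw [← appHom_homMod, ← appHom_homMod, ← I.appHom_incl f hf, ← appHom_comp, ← appHom_comp,
          h]
      refine hom_ext_elements fun Y y => ?_
      obtain ⟨f, rfl⟩ := homElement_surjective y
      rw [appHom_homMod, appHom_homMod g', key]
    · intro g
      obtain ⟨φ, hφ, rfl⟩ := exists_isPartialHom g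
      obtain ⟨x, hx⟩ := h₂ I hI φ hφ
      refine ⟨ofElement x, hom_ext_elements fun Y y => ?_⟩
      obtain ⟨f, hf, rfl⟩ := I.element_surjective y
      rw [appHom_comp, appHom_incl, appHom_ofElement, hφ.appHom_hom, hx Y f hf]

lemma ann_zero_mem : ann (0 : M.obj.obj X) ∈ F.ideals X :=
  F.up_closed (F.top_mem X) fun _ f _ => map_zero (act M f)

variable {F}

lemma ann_add_mem {x y : M.obj.obj X} (hx : ann x ∈ F.ideals X) (hy : ann y ∈ F.ideals X) :
    ann (x + y) ∈ F.ideals X :=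
  F.up_closed (F.inter_mem hx hy) fun Y f ⟨(hf : act M f x = 0), (hf' : act M f y = 0)⟩ =>
    show act M f (x + y) = 0 by rw [map_add, hf, hf', add_zero]

lemma ann_neg_mem {x : M.obj.obj X} (hx : ann x ∈ F.ideals X) : ann (-x) ∈ F.ideals X :=
  F.up_closed hx fun Y f (hf : act M f x = 0) =>
    show act M f (-x) = 0 by rw [map_neg, hf, neg_zero]

lemma ann_act_mem {x : M.obj.obj X} (f : X ⟶ Y) (hx : ann x ∈ F.ideals X) :
    ann (act M f x) ∈ F.ideals Y := by
  rw [ann_act]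
  exact F.colon_mem f hx

/-- Torsion is a local property: this is the transitivity axiom, since `ann (f x) = (ann x : f)`. -/
lemma ann_mem_of_act {I : LeftIdeal X} (hI : I ∈ F.ideals X) {x : M.obj.obj X}
    (h : ∀ Y, ∀ f ∈ I.carrier Y, ann (act M f x) ∈ F.ideals Y) : ann x ∈ F.ideals X :=
  F.trans_mem hI fun Y f hf => by
    rw [← ann_act]
    exact h Y f hf

lemma IsTorsionFree.appHom_eq_zero (hN : F.IsTorsionFree N) (g : M ⟶ N) {x : M.obj.obj X}
    (hx : ann x ∈ F.ideals X) : appHom g X x = 0 :=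
  hN _ hx _ fun Y f hf => by rw [← appHom_act, mem_ann.1 hf, map_zero]

variable (F) in
/-- A morphism of modules is a local isomorphism if its kernel and its cokernel are torsion. -/
structure IsLocalIso (η : M ⟶ N) : Prop where
  ker : ∀ ⦃X : C⦄ (x : M.obj.obj X), appHom η X x = 0 → ann x ∈ F.ideals X
  coker : ∀ ⦃X : C⦄ (y : N.obj.obj X), conductor η y ∈ F.ideals X

lemma IsLocalIso.comp_isIso {η : M ⟶ N} (hη : F.IsLocalIso η) (e : N ⟶ L) [IsIso e] :
    F.IsLocalIso (η ≫ e) where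
  ker X x hx := hη.ker x ((injective_of_mono e X) (by rw [← appHom_comp, hx, map_zero]))
  coker X y := by
    obtain ⟨y, rfl⟩ := (bijective_of_isIso e X).2 y
    refine F.up_closed (hη.coker y) ?_
    rintro Y f ⟨m, hm⟩
    exact ⟨m, by rw [appHom_comp, hm, appHom_act]⟩

open Classical in
-- The value of the extension at `u` is forced on the conductor of `u`, where `f u` comes from `M`.
-- That conductor is in the filter, so closedness of `N` supplies exactly one element with these
-- values.
theorem IsLocalIso.existsUnique_extension {η : M ⟶ L} (hη : F.IsLocalIso η)
    (hN : F.closedModules N) (g : M ⟶ N) : ∃! g' : L ⟶ N, η ≫ g' = g := by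
  obtain ⟨h₁, h₂⟩ := F.closedModules_iff.1 hN
  have hwd : ∀ {Y : C} {m m' : M.obj.obj Y}, appHom η Y m = appHom η Y m' →
      appHom g Y m = appHom g Y m' := fun {Y m m'} h => by
    rw [← sub_eq_zero, ← map_sub]
    exact h₁.appHom_eq_zero g (hη.ker _ (by rw [map_sub, h, sub_self]))
  -- `S u n` is the graph of the extension. Allowing any member `I`, not just the conductor, makes
  -- additivity and naturality consequences of uniqueness.
  let S : ∀ {X : C}, L.obj.obj X → N.obj.obj X → Prop := fun {X} u n =>
    ∃ I ∈ F.ideals X, ∀ Y, ∀ f ∈ I.carrier Y, ∃ m, appHom η Y m = act L f u ∧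
      appHom g Y m = act N f n
  have hS : ∀ {X : C} {u : L.obj.obj X} {n n' : N.obj.obj X}, S u n → S u n' → n = n' := by
    rintro X u n n' ⟨I, hI, h⟩ ⟨J, hJ, h'⟩
    refine h₁.eq_of_act_eq (F.inter_mem hI hJ) fun Y f hf => ?_
    obtain ⟨m, hm, e⟩ := h Y f hf.1
    obtain ⟨m', hm', e'⟩ := h' Y f hf.2
    rw [← e, ← e', hwd (hm.trans hm'.symm)]
  have hex : ∀ {X : C} (u : L.obj.obj X), ∃ n, S u n := by
    intro X u
    -- The choice of `m` is harmless by `hwd`, and the default 0 lies outside the conductor, where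
    -- `φ` is never used.
    let φ : ∀ Y, (X ⟶ Y) → N.obj.obj Y := fun Y f =>
      if h : ∃ m, appHom η Y m = act L f u then appHom g Y h.choose else 0
    have hφ : ∀ {Y} {f : X ⟶ Y} {m}, appHom η Y m = act L f u → φ Y f = appHom g Y m := by
      intro Y f m hm
      have h : ∃ m, appHom η Y m = act L f u := ⟨m, hm⟩
      simp only [φ, dif_pos h]
      exact hwd (h.choose_spec.trans hm.symm)
    obtain ⟨n, hn⟩ := h₂ _ (hη.coker u) φ
      ⟨fun {Y f f'} ⟨m, hm⟩ ⟨m', hm'⟩ => by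
        rw [hφ hm, hφ hm', ← map_add, hφ (m := m + m') (by rw [map_add, hm, hm', add_act])],
      fun {Y Z f} h ⟨m, hm⟩ => by
        rw [hφ hm, ← appHom_act, hφ (m := act M h m) (by rw [appHom_act, hm, act_comp])]⟩
    refine ⟨n, _, hη.coker u, fun Y f hf => ?_⟩
    obtain ⟨m, hm⟩ := hf
    exact ⟨m, hm, by rw [← hn Y f ⟨m, hm⟩, hφ hm]⟩
  choose ψ hψ using fun X => hex (X := X)
  have hψη : ∀ {X : C} (m : M.obj.obj X), ψ X (appHom η X m) = appHom g X m := fun {X} m =>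
    hS (hψ X _) ⟨⊤, F.top_mem X, fun Y f _ => ⟨act M f m, appHom_act _ _ _, appHom_act _ _ _⟩⟩
  refine ⟨mkHom (fun X => AddMonoidHom.mk' (ψ X) fun u u' => ?_) fun {X Y} f u => ?_, ?_, ?_⟩
  · obtain ⟨I, hI, h⟩ := hψ X u
    obtain ⟨J, hJ, h'⟩ := hψ X u'
    refine hS (hψ X _) ⟨_, F.inter_mem hI hJ, fun Y f hf => ?_⟩
    obtain ⟨m, hm, e⟩ := h Y f hf.1
    obtain ⟨m', hm', e'⟩ := h' Y f hf.2
    exact ⟨m + m', by rw [map_add, map_add, hm, hm'], by rw [map_add, map_add, e, e']⟩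
  · obtain ⟨I, hI, h⟩ := hψ X u
    refine hS (hψ Y _) ⟨_, F.colon_mem f hI, fun Z f' hf => ?_⟩
    obtain ⟨m, hm, e⟩ := h Z _ hf
    exact ⟨m, by rw [hm, act_comp], by rw [e, act_comp]; rfl⟩
  · exact hom_ext_elements fun X m => hψη m
  · rintro g' rfl
    refine hom_ext_elements fun X u => ?_
    refine hS ⟨_, hη.coker u, ?_⟩ (hψ X u)
    rintro Y f ⟨m, hm⟩
    exact ⟨m, hm, by rw [appHom_comp, hm, appHom_act]⟩

end LeftGabrielFilter

end Localization

/-! ### Construction of the localization by germs modulo torsion. -/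

section Germs

variable {C : Type u} [Category.{v} C] [Preadditive C] {M N L : LMod C} {X Y Z : C}

open LeftIdeal

namespace LeftGabrielFilter

variable (F : LeftGabrielFilter C)

/-- The families of functions that restrict, on some member of the filter, to a partial
homomorphism up to torsion. -/
def germs (M : LMod C) (X : C) : AddSubgroup (∀ Y, (X ⟶ Y) → M.obj.obj Y) where
  carrier := {φ | ∃ I ∈ F.ideals X,
    (∀ Y, ∀ f ∈ I.carrier Y, ∀ g ∈ I.carrier Y, ann (φ Y (f + g) - φ Y f - φ Y g) ∈ F.ideals Y) ∧
    ∀ Y, ∀ f ∈ I.carrier Y, ∀ Z (g : Y ⟶ Z), ann (φ Z (f ≫ g) - act M g (φ Y f)) ∈ F.ideals Z}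
  zero_mem' := ⟨⊤, F.top_mem X, fun _ _ _ _ _ => by simpa using F.ann_zero_mem,
    fun _ _ _ _ _ => by simpa using F.ann_zero_mem⟩
  add_mem' := by
    rintro φ ψ ⟨I, hI, h₁, h₂⟩ ⟨J, hJ, h₃, h₄⟩
    refine ⟨_, F.inter_mem hI hJ, fun Y f hf g hg => ?_, fun Y f hf Z g => ?_⟩
    · convert ann_add_mem (h₁ Y f hf.1 g hg.1) (h₃ Y f hf.2 g hg.2) using 2
      simp only [Pi.add_apply]
      abel
    · convert ann_add_mem (h₂ Y f hf.1 Z g) (h₄ Y f hf.2 Z g) using 2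
      simp only [Pi.add_apply, map_add]
      abel
  neg_mem' := by
    rintro φ ⟨I, hI, h₁, h₂⟩
    refine ⟨I, hI, fun Y f hf g hg => ?_, fun Y f hf Z g => ?_⟩
    · convert ann_neg_mem (h₁ Y f hf g hg) using 2
      simp only [Pi.neg_apply]
      abel
    · convert ann_neg_mem (h₂ Y f hf Z g) using 2
      simp only [Pi.neg_apply, map_neg]
      abel

/-- The families of functions that are torsion on some member of the filter. -/
def nullGerms (M : LMod C) (X : C) : AddSubgroup (∀ Y, (X ⟶ Y) → M.obj.obj Y) where
  carrier := {φ | ∃ I ∈ F.ideals X, ∀ Y, ∀ f ∈ I.carrier Y, ann (φ Y f) ∈ F.ideals Y}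
  zero_mem' := ⟨⊤, F.top_mem X, fun _ _ _ => F.ann_zero_mem⟩
  add_mem' := by
    rintro φ ψ ⟨I, hI, h⟩ ⟨J, hJ, h'⟩
    exact ⟨_, F.inter_mem hI hJ, fun Y f hf => ann_add_mem (h Y f hf.1) (h' Y f hf.2)⟩
  neg_mem' := by
    rintro φ ⟨I, hI, h⟩
    exact ⟨I, hI, fun Y f hf => ann_neg_mem (h Y f hf)⟩

/-- Precomposition of families of functions with a morphism. -/
def precomp (M : LMod C) (h : X ⟶ Y) :
    (∀ Z, (X ⟶ Z) → M.obj.obj Z) →+ (∀ Z, (Y ⟶ Z) → M.obj.obj Z) where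
  toFun φ Z f := φ Z (h ≫ f)
  map_zero' := rfl
  map_add' _ _ := rfl

lemma precomp_mem_germs (h : X ⟶ Y) {φ : ∀ Z, (X ⟶ Z) → M.obj.obj Z} (hφ : φ ∈ F.germs M X) :
    precomp M h φ ∈ F.germs M Y := by
  obtain ⟨I, hI, h₁, h₂⟩ := hφ
  refine ⟨_, F.colon_mem h hI, fun Z f hf g hg => ?_, fun Z f hf W g => ?_⟩
  · simpa [precomp] using h₁ Z _ hf _ hg
  · simpa [precomp] using h₂ Z _ hf W g

lemma precomp_mem_nullGerms (h : X ⟶ Y) {φ : ∀ Z, (X ⟶ Z) → M.obj.obj Z}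
    (hφ : φ ∈ F.nullGerms M X) : precomp M h φ ∈ F.nullGerms M Y := by
  obtain ⟨I, hI, h₁⟩ := hφ
  exact ⟨_, F.colon_mem h hI, fun Z f hf => h₁ Z _ hf⟩

/-- The group of germs of partial homomorphisms up to torsion. -/
abbrev Germ (M : LMod C) (X : C) : Type max u v :=
  F.germs M X ⧸ (F.nullGerms M X).addSubgroupOf (F.germs M X)

/-- The action of a morphism on germs. -/
def germMap (M : LMod C) (h : X ⟶ Y) : F.Germ M X →+ F.Germ M Y :=
  QuotientAddGroup.map _ _
    (((precomp M h).comp (F.germs M X).subtype).codRestrict (F.germs M Y)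
      fun φ => F.precomp_mem_germs h φ.2)
    (fun _ hφ => F.precomp_mem_nullGerms h hφ)

lemma germMap_mk (h : X ⟶ Y) (φ : F.germs M X) :
    F.germMap M h φ = ((⟨precomp M h φ, F.precomp_mem_germs h φ.2⟩ : F.germs M Y) :
      F.Germ M Y) := rfl

lemma germMap_id (M : LMod C) (X : C) : F.germMap M (𝟙 X) = AddMonoidHom.id _ := by
  ext φ
  simp [germMap_mk, precomp]

lemma germMap_comp (M : LMod C) (h : X ⟶ Y) (h' : Y ⟶ Z) :
    F.germMap M (h ≫ h') = (F.germMap M h').comp (F.germMap M h) := by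
  ext φ
  simp [germMap_mk, precomp]

lemma germ_eq_iff {φ ψ : F.germs M X} :
    (φ : F.Germ M X) = ψ ↔ (φ - ψ : ∀ Z, (X ⟶ Z) → M.obj.obj Z) ∈ F.nullGerms M X := by
  rw [← sub_eq_zero]
  exact QuotientAddGroup.eq_zero_iff (φ - ψ)

/-- Both `h ≫ f` and `h' ≫ f` lie in `I` for `f` in `(I : h) ⊓ (I : h')`, and there the failure of
additivity is torsion. -/
lemma germMap_add (M : LMod C) (h h' : X ⟶ Y) :
    F.germMap M (h + h') = F.germMap M h + F.germMap M h' := by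
  ext φ
  obtain ⟨φ, I, hI, h₁, h₂⟩ := φ
  refine F.germ_eq_iff.2 ⟨_, F.inter_mem (F.colon_mem h hI) (F.colon_mem h' hI), fun Z f hf => ?_⟩
  convert h₁ Z _ hf.1 _ hf.2 using 2
  simp [precomp, sub_sub]

variable {F} in
-- A germ is determined by its values on a small skeleton: naturality modulo torsion carries values
-- along isomorphisms. Hence the group of germs is small.
lemma mem_nullGerms_of_smallModel [EssentiallySmall.{v} C] {φ : ∀ Z, (X ⟶ Z) → M.obj.obj Z}
    (hφ : φ ∈ F.germs M X)
    (h : ∀ (Y : SmallModel.{v} C) (f : X ⟶ (equivSmallModel C).inverse.obj Y), φ _ f = 0) :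
    φ ∈ F.nullGerms M X := by
  obtain ⟨I, hI, -, h₂⟩ := hφ
  refine ⟨I, hI, fun Y f hf => ?_⟩
  let i : Y ≅ (equivSmallModel.{v} C).inverse.obj ((equivSmallModel.{v} C).functor.obj Y) :=
    (equivSmallModel.{v} C).unitIso.app Y
  have := ann_act_mem i.inv (ann_neg_mem (h₂ Y f hf _ i.hom))
  rw [h, zero_sub, neg_neg, ← act_comp, i.hom_inv_id, act_id] at this
  exact this

instance [EssentiallySmall.{v} C] (M : LMod C) (X : C) : Small.{v} (F.Germ M X) := by
  refine small_of_injective (β := ∀ (Y : SmallModel.{v} C)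
    (_ : X ⟶ (equivSmallModel C).inverse.obj Y), M.obj.obj ((equivSmallModel C).inverse.obj Y))
    (f := fun a Y f => a.out.1 _ f) fun a b hab => ?_
  rw [← a.out_eq, ← b.out_eq, ← sub_eq_zero]
  refine (QuotientAddGroup.eq_zero_iff (a.out - b.out)).2
    (mem_nullGerms_of_smallModel (a.out - b.out).2 fun Y f => sub_eq_zero.2 ?_)
  exact congrFun (congrFun hab Y) f

/-- The family of functions `f ↦ f x` attached to an element `x` of a module. -/
def elementGerm (M : LMod C) (X : C) : M.obj.obj X →+ F.germs M X where
  toFun x := ⟨fun _ f => act M f x, ⊤, F.top_mem X,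
    fun Y f _ g _ => by
      dsimp only
      rw [add_act, add_sub_cancel_left, sub_self]
      exact F.ann_zero_mem,
    fun Y f _ Z g => by
      dsimp only
      rw [act_comp, sub_self]
      exact F.ann_zero_mem⟩
  map_zero' := by
    ext
    simp
  map_add' x y := by
    ext
    simp

lemma elementGerm_apply (x : M.obj.obj X) (f : X ⟶ Y) :
    (F.elementGerm M X x).1 Y f = act M f x := rfl

variable [EssentiallySmall.{v} C]

/-- The localization of a module at a Gabriel filter. -/
def loc (M : LMod C) : LMod C :=
  letI G : C ⥤ AddCommGrpCat.{v} :=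
    { obj := fun X => AddCommGrpCat.of (Shrink.{v} (F.Germ M X))
      map := fun {X Y} h => AddCommGrpCat.ofHom
        (((Shrink.addEquiv (α := F.Germ M Y)).symm.toAddMonoidHom.comp (F.germMap M h)).comp
          (Shrink.addEquiv (α := F.Germ M X)).toAddMonoidHom)
      map_id := fun X => by
        ext x
        simp [germMap_id]
      map_comp := fun {X Y Z} h h' => by
        ext x
        simp [germMap_comp] }
  haveI : G.Additive := ⟨fun {X Y f h} => by
    ext x
    simp [G, germMap_add]⟩
  AdditiveFunctor.of G

/-- The class of a family of functions in the localization. -/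
def locMk (M : LMod C) (X : C) : F.germs M X →+ (F.loc M).obj.obj X :=
  (Shrink.addEquiv (α := F.Germ M X)).symm.toAddMonoidHom.comp (QuotientAddGroup.mk' _)

lemma locMk_surjective (u : (F.loc M).obj.obj X) : ∃ φ, F.locMk M X φ = u :=
  ((Shrink.addEquiv (α := F.Germ M X)).symm.surjective.comp QuotientAddGroup.mk_surjective) u

variable {F} in
lemma locMk_eq_iff {φ ψ : F.germs M X} : F.locMk M X φ = F.locMk M X ψ ↔
    (φ - ψ : ∀ Z, (X ⟶ Z) → M.obj.obj Z) ∈ F.nullGerms M X :=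
  (Shrink.addEquiv (α := F.Germ M X)).symm.injective.eq_iff.trans F.germ_eq_iff

variable {F} in
lemma locMk_eq_zero_iff {φ : F.germs M X} : F.locMk M X φ = 0 ↔ φ.1 ∈ F.nullGerms M X := by
  rw [← map_zero (F.locMk M X), locMk_eq_iff]
  simp

lemma act_locMk (h : X ⟶ Y) (φ : F.germs M X) : act (F.loc M) h (F.locMk M X φ) =
    F.locMk M Y ⟨precomp M h φ, F.precomp_mem_germs h φ.2⟩ := by
  change (Shrink.addEquiv (α := F.Germ M Y)).symm (F.germMap M h
    ((Shrink.addEquiv (α := F.Germ M X)) ((Shrink.addEquiv (α := F.Germ M X)).symm φ))) = _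
  rw [AddEquiv.apply_symm_apply, germMap_mk]
  rfl

/-- The canonical morphism from a module to its localization. -/
def toLoc (M : LMod C) : M ⟶ F.loc M :=
  mkHom (fun X => (F.locMk M X).comp (F.elementGerm M X)) fun {X Y} f x => by
    simp only [AddMonoidHom.comp_apply, act_locMk]
    congr 1
    ext Z g
    simp [elementGerm_apply, precomp, act_comp]

variable {F}

lemma toLoc_eq_zero_iff (x : M.obj.obj X) : appHom (F.toLoc M) X x = 0 ↔ ann x ∈ F.ideals X := by
  refine locMk_eq_zero_iff.trans ⟨?_, fun h => ?_⟩
  · rintro ⟨I, hI, h⟩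
    exact ann_mem_of_act hI h
  · exact ⟨⊤, F.top_mem X, fun Y f _ => ann_act_mem f h⟩

/-- For `f` in `I`, the families `g ↦ φ (f ≫ g)` and `g ↦ g (φ f)` differ by torsion, so they define
the same germ. -/
lemma exists_act_locMk (φ : F.germs M X) : ∃ I ∈ F.ideals X, ∀ Y, ∀ f ∈ I.carrier Y,
    act (F.loc M) f (F.locMk M X φ) = appHom (F.toLoc M) Y (φ.1 Y f) := by
  obtain ⟨φ, I, hI, h₁, h₂⟩ := φ
  refine ⟨I, hI, fun Y f hf => ?_⟩
  rw [act_locMk]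
  exact locMk_eq_iff.2 ⟨⊤, F.top_mem Y, fun Z g _ => h₂ Y f hf Z g⟩

lemma toLoc_isLocalIso (M : LMod C) : F.IsLocalIso (F.toLoc M) where
  ker _ x hx := (toLoc_eq_zero_iff x).1 hx
  coker X u := by
    obtain ⟨φ, rfl⟩ := F.locMk_surjective u
    obtain ⟨I, hI, h⟩ := exists_act_locMk φ
    exact F.up_closed hI fun Y f hf => ⟨_, (h Y f hf).symm⟩

lemma loc_isTorsionFree (M : LMod C) : F.IsTorsionFree (F.loc M) := by
  intro X J hJ u hu
  obtain ⟨φ, rfl⟩ := F.locMk_surjective u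
  obtain ⟨I, hI, h⟩ := exists_act_locMk φ
  refine locMk_eq_zero_iff.2 ⟨_, F.inter_mem hI hJ, fun Y f hf => ?_⟩
  rw [← toLoc_eq_zero_iff, ← h Y f hf.1]
  exact hu Y f hf.2

open Classical in
theorem loc_closed (M : LMod C) : F.closedModules (F.loc M) := by
  refine F.closedModules_iff.2 ⟨loc_isTorsionFree M, fun X I hI Φ hΦ => ?_⟩
  -- `J` is the part of `I` on which `Φ` lifts to `M`. It is in the filter by transitivity, as the
  -- cokernel of `toLoc` is torsion.
  let J : LeftIdeal X :=
    { carrier := fun Y =>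
        { carrier := {f | f ∈ I.carrier Y ∧ ∃ m, appHom (F.toLoc M) Y m = Φ Y f}
          zero_mem' := ⟨zero_mem _, 0, by
            have := hΦ.map_add (zero_mem (I.carrier Y)) (zero_mem _)
            rw [add_zero, left_eq_add] at this
            rw [this, map_zero]⟩
          add_mem' := by
            rintro f g ⟨hf, m, hm⟩ ⟨hg, m', hm'⟩
            exact ⟨add_mem hf hg, m + m', by rw [map_add, hm, hm', hΦ.map_add hf hg]⟩
          neg_mem' := by
            rintro f ⟨hf, m, hm⟩
            refine ⟨neg_mem hf, -m, ?_⟩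
            -- Compatibility with negatives is naturality with respect to `-𝟙 Y`.
            have h := hΦ.map_comp (-𝟙 Y) hf
            rw [Preadditive.comp_neg, Category.comp_id, neg_act, act_id] at h
            rw [map_neg, hm, h] }
      comp_mem := by
        rintro Y Z f g ⟨hf, m, hm⟩
        exact ⟨I.comp_mem g hf, act M g m, by rw [appHom_act, hm, hΦ.map_comp g hf]⟩ }
  have hJ : J ∈ F.ideals X := F.trans_mem hI fun Y f hf => by
    refine F.up_closed ((toLoc_isLocalIso M).coker (Φ Y f)) ?_
    rintro Z g ⟨m, hm⟩
    exact ⟨I.comp_mem g hf, m, by rw [hm, hΦ.map_comp g hf]⟩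
  -- Arbitrary lifts of `Φ` are additive and natural up to the kernel of `toLoc`, which is torsion;
  -- so they form a germ without any coherent choice.
  let φ : ∀ Y, (X ⟶ Y) → M.obj.obj Y := fun Y f =>
    if h : ∃ m, appHom (F.toLoc M) Y m = Φ Y f then h.choose else 0
  have hφ : ∀ {Y} {f : X ⟶ Y}, f ∈ J.carrier Y → appHom (F.toLoc M) Y (φ Y f) = Φ Y f := by
    intro Y f hf
    simp only [φ, dif_pos hf.2]
    exact hf.2.choose_spec
  have hmem : φ ∈ F.germs M X := by
    refine ⟨J, hJ, fun Y f hf g hg => ?_, fun Y f hf Z g => ?_⟩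
    · rw [← toLoc_eq_zero_iff, map_sub, map_sub, hφ hf, hφ hg, hφ (add_mem hf hg),
        hΦ.map_add hf.1 hg.1, add_sub_cancel_left, sub_self]
    · rw [← toLoc_eq_zero_iff, map_sub, appHom_act, hφ hf, hφ (J.comp_mem g hf),
        hΦ.map_comp g hf.1, sub_self]
  obtain ⟨K, hK, h⟩ := exists_act_locMk ⟨φ, hmem⟩
  refine ⟨F.locMk M X ⟨φ, hmem⟩, fun Y f hf => ?_⟩
  refine (loc_isTorsionFree M).eq_of_act_eq (F.colon_mem f (F.inter_mem hJ hK)) fun Z g hg => ?_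
  rw [← hΦ.map_comp g hf, ← act_comp, h Z _ hg.2]
  exact (hφ hg.1).symm

end LeftGabrielFilter

end Germs

/-! ### Reflectivity of the closed modules and preservation of kernels. -/

section Reflection

variable {C : Type u} [Category.{v} C] [Preadditive C] {M N L : LMod C} {X Y Z : C}

open LeftIdeal

/-- A morphism whose values lie in the image of an objectwise injective morphism lifts along it. -/
lemma exists_lift_of_injective (j : M ⟶ N) (hj : ∀ X, Function.Injective (appHom j X))
    (z : L ⟶ N) (h : ∀ X w, ∃ x, appHom j X x = appHom z X w) : ∃ l : L ⟶ M, l ≫ j = z := by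
  choose ψ hψ using h
  refine ⟨mkHom (fun X => AddMonoidHom.mk' (ψ X) fun w w' => hj X ?_) fun {X Y} f w => hj Y ?_,
    hom_ext_elements hψ⟩
  · rw [map_add, hψ, hψ, hψ, map_add]
  · change appHom j Y (ψ Y _) = appHom j Y (act M f (ψ X w))
    rw [appHom_act, hψ, hψ, appHom_act]

lemma exists_kernelFork_lift {f : M ⟶ N} {c : KernelFork f} (hc : IsLimit c) {x : M.obj.obj X}
    (hx : appHom f X x = 0) : ∃ k, appHom c.ι X k = x := by
  obtain ⟨l, hl⟩ := KernelFork.IsLimit.lift' hc (ofElement x) (by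
    rw [← ofElement_appHom, hx]
    exact hom_ext_elements fun Y y => map_zero (act N y))
  refine ⟨appHom l X (homElement (𝟙 X)), ?_⟩
  rw [← appHom_comp, hl, appHom_ofElement, act_id]

namespace LeftGabrielFilter

variable {F : LeftGabrielFilter C}

open Classical in
/-- A closed submodule of a torsion-free module is saturated. -/
lemma exists_preimage_of_conductor_mem (hM : F.closedModules M) (hN : F.IsTorsionFree N)
    (j : M ⟶ N) (hj : ∀ X, Function.Injective (appHom j X)) (y : N.obj.obj X)
    (hy : conductor j y ∈ F.ideals X) : ∃ x, appHom j X x = y := by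
  let φ : ∀ Y, (X ⟶ Y) → M.obj.obj Y := fun Y f =>
    if h : ∃ m, appHom j Y m = act N f y then h.choose else 0
  have hφ : ∀ {Y} {f : X ⟶ Y}, f ∈ (conductor j y).carrier Y →
      appHom j Y (φ Y f) = act N f y := by
    intro Y f hf
    simp only [φ, dif_pos (mem_conductor.1 hf)]
    exact (mem_conductor.1 hf).choose_spec
  obtain ⟨x, hx⟩ := (F.closedModules_iff.1 hM).2 _ hy φ
    ⟨fun hf hg => hj _ (by rw [map_add, hφ hf, hφ hg, hφ (add_mem hf hg), add_act]),
      fun g hf => hj _ (by rw [appHom_act, hφ hf, hφ (comp_mem _ g hf), act_comp])⟩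
  exact ⟨x, hN.eq_of_act_eq hy fun Y f hf => by rw [← appHom_act, ← hx Y f hf, hφ hf]⟩

lemma IsLocalIso.bijective {η : M ⟶ N} (hη : F.IsLocalIso η) (hM : F.closedModules M)
    (hN : F.IsTorsionFree N) (X : C) : Function.Bijective (appHom η X) := by
  have hinj : ∀ X, Function.Injective (appHom η X) := fun X =>
    (injective_iff_map_eq_zero _).2 fun x hx =>
      (F.closedModules_iff.1 hM).1.eq_zero_of_ann_mem (hη.ker x hx)
  exact ⟨hinj X, fun y => exists_preimage_of_conductor_mem hM hN η hinj y (hη.coker y)⟩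

section Exactness

variable {K K' M' N' : LMod C} {k : K ⟶ M} {f : M ⟶ N} {k' : K' ⟶ M'} {f' : M' ⟶ N'}
  {ηK : K ⟶ K'} {ηM : M ⟶ M'} {ηN : N ⟶ N'}

/-- A morphism induced on localizations by an injective morphism is injective. -/
lemma injective_of_isLocalIso (hηK : F.IsLocalIso ηK) (hηM : F.IsLocalIso ηM)
    (hK' : F.IsTorsionFree K') (hk : ∀ X, Function.Injective (appHom k X))
    (w : ηK ≫ k' = k ≫ ηM) (X : C) : Function.Injective (appHom k' X) := by
  -- If `h u = ηK m`, then `ηM (k m) = 0`, so `k m` is torsion; as `k` is injective, `m` is torsion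
  -- and `ηK m = 0`.
  refine (injective_iff_map_eq_zero _).2 fun u hu => hK' _ (hηK.coker u) _ ?_
  rintro Y h ⟨m, hm⟩
  have h0 : appHom ηM Y (appHom k Y m) = 0 := by
    rw [← appHom_comp, ← w, appHom_comp, hm, appHom_act, hu, map_zero]
  rw [← hm]
  refine hK'.appHom_eq_zero ηK (F.up_closed (hηM.ker _ h0) fun Z g hg => hk Z ?_)
  rw [appHom_act, map_zero]
  exact hg

/-- Localization turns a kernel into a kernel. -/
lemma exists_preimage_of_isLocalIso (hηK : F.IsLocalIso ηK) (hηM : F.IsLocalIso ηM)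
    (hηN : F.IsLocalIso ηN) (hK' : F.closedModules K') (hM' : F.IsTorsionFree M')
    (hk : ∀ X, Function.Injective (appHom k X))
    (hkf : ∀ {X} (x : M.obj.obj X), appHom f X x = 0 → ∃ y, appHom k X y = x)
    (w : ηK ≫ k' = k ≫ ηM) (w' : ηM ≫ f' = f ≫ ηN) {y : M'.obj.obj X}
    (hy : appHom f' X y = 0) : ∃ u, appHom k' X u = y := by
  refine exists_preimage_of_conductor_mem hK' hM' k'
    (injective_of_isLocalIso hηK hηM (F.closedModules_iff.1 hK').1 hk w) y
    (F.trans_mem (hηM.coker y) ?_)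
  rintro Y h ⟨m, hm⟩
  -- Here `f m` is torsion, and every `g` killing it sends `m` into the kernel `K`; so `(conductor
  -- k' y : h)` contains `ann (f m)`.
  have h0 : appHom ηN Y (appHom f Y m) = 0 := by
    rw [← appHom_comp, ← w', appHom_comp, hm, appHom_act, hy, map_zero]
  refine F.up_closed (hηN.ker _ h0) fun Z g hg => ?_
  obtain ⟨κ, hκ⟩ := hkf (act M g m) (by rw [appHom_act]; exact hg)
  exact ⟨appHom ηK Z κ, by
    rw [← appHom_comp, w, appHom_comp, hκ, appHom_act, hm, act_comp]⟩

end Exactness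

section Reflective

variable [EssentiallySmall.{v} C]

variable (F) in
/-- The universal property of the localization. -/
def locHomEquiv (M : LMod C) (N : F.closedModules.FullSubcategory) :
    ((⟨F.loc M, loc_closed M⟩ : F.closedModules.FullSubcategory) ⟶ N) ≃
      (M ⟶ F.closedModules.ι.obj N) :=
  Equiv.ofBijective (fun g => F.toLoc M ≫ g.hom) (by
    have H := fun g : M ⟶ N.obj => (toLoc_isLocalIso M).existsUnique_extension N.property g
    refine ⟨fun g g' h => ObjectProperty.hom_ext _ ((H _).unique h rfl), fun g => ?_⟩
    obtain ⟨g', hg', -⟩ := H g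
    exact ⟨ObjectProperty.homMk g', hg'⟩)

variable (F) in
/-- Localization is left adjoint to the inclusion of the closed modules. -/
def locAdjunction : Adjunction.leftAdjointOfEquiv (G := F.closedModules.ι) F.locHomEquiv
    (fun _ _ _ _ _ => rfl) ⊣ F.closedModules.ι :=
  Adjunction.adjunctionOfEquivLeft _ _

lemma locAdjunction_unit_app (M : LMod C) : F.locAdjunction.unit.app M = F.toLoc M := by
  exact Category.comp_id (F.toLoc M)

/-- Uniqueness of left adjoints transfers the property from `toLoc` to the unit of an arbitrary
reflector. -/
lemma unit_isLocalIso {a : LMod C ⥤ F.closedModules.FullSubcategory}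
    (adj : a ⊣ F.closedModules.ι) (M : LMod C) : F.IsLocalIso (adj.unit.app M) := by
  rw [← Adjunction.unit_leftAdjointUniq_hom_app F.locAdjunction adj, locAdjunction_unit_app]
  exact (toLoc_isLocalIso M).comp_isIso _

theorem preservesKernel {a : LMod C ⥤ F.closedModules.FullSubcategory}
    (adj : a ⊣ F.closedModules.ι) (f : M ⟶ N) : PreservesLimit (parallelPair f 0) a where
  preserves {c : KernelFork f} hc := by
    have : a.Additive := adj.left_adjoint_additive
    have hk : ∀ X, Function.Injective (appHom (Fork.ι c) X) := fun X => by
      have : Mono (Fork.ι c) := mono_of_isLimit_fork hc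
      exact injective_of_mono _ X
    have w : ∀ {P Q : LMod C} (g : P ⟶ Q),
        adj.unit.app P ≫ (a.map g).hom = g ≫ adj.unit.app Q := fun g =>
      (adj.unit.naturality g).symm
    have hinj := injective_of_isLocalIso (unit_isLocalIso adj _) (unit_isLocalIso adj _)
      (F.closedModules_iff.1 (a.obj c.pt).property).1 hk (w (Fork.ι c))
    have : Mono (F.closedModules.ι.map (a.map (Fork.ι c))) := mono_of_injective _ hinj
    have : Mono (a.map (Fork.ι c)) := F.closedModules.ι.mono_of_mono_map this
    refine ⟨(KernelFork.isLimitMapConeEquiv c a).symm (KernelFork.IsLimit.ofι' _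
      (KernelFork.map_condition c a) fun {Z} z hz => ?_)⟩
    have hl := exists_lift_of_injective (a.map (Fork.ι c)).hom hinj z.hom fun X t =>
      exists_preimage_of_isLocalIso (unit_isLocalIso adj _) (unit_isLocalIso adj _)
        (unit_isLocalIso adj _) (a.obj c.pt).property
        (F.closedModules_iff.1 (a.obj M).property).1 hk
        (fun x hx => exists_kernelFork_lift hc hx) (w (Fork.ι c)) (w f)
        (y := appHom z.hom X t) (by
          rw [← appHom_comp]
          exact congrArg (fun g => appHom (InducedCategory.Hom.hom g) X t) hz)
    exact ⟨ObjectProperty.homMk hl.choose, ObjectProperty.hom_ext _ hl.choose_spec⟩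

variable (F) in
theorem closedModules_isGiraud : IsGiraud F.closedModules :=
  have h : F.closedModules.ι.IsRightAdjoint := ⟨_, ⟨F.locAdjunction⟩⟩
  ⟨h, fun f => preservesKernel (Adjunction.ofIsRightAdjoint F.closedModules.ι) f⟩

end Reflective

end LeftGabrielFilter

end Reflection

/-! ### The torsion class and Gabriel filter of a Giraud subcategory. -/

namespace GiraudSubcategory

variable {C : Type u} [Category.{v} C] [Preadditive C] {M N L : LMod C} {X Y Z : C}
  (B B' : GiraudSubcategory (LMod C))

open LeftIdeal

/-- The reflector is left adjoint to the inclusion. -/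
def adj : B.reflector ⊣ B.objs.ι :=
  haveI := B.isGiraud.reflective
  Adjunction.ofIsRightAdjoint B.objs.ι

instance : B.reflector.Additive := B.adj.left_adjoint_additive

instance : B.reflector.IsLeftAdjoint := B.adj.isLeftAdjoint

instance (f : M ⟶ N) : PreservesLimit (parallelPair f 0) B.reflector :=
  B.isGiraud.preserves_kernels f

lemma isZero_quotRange_id (M : LMod C) : IsZero (quotRange (𝟙 M)) := by
  rw [IsZero.iff_id_eq_zero]
  refine hom_ext_elements fun X x => ?_
  obtain ⟨x, rfl⟩ := quotRangeMk_surjective (𝟙 M) X x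
  exact (quotRangeMk_eq_zero_iff _ _).2 ⟨x, rfl⟩

lemma reflector_exists_lift {f : M ⟶ N} {k : L ⟶ M} {w : k ≫ f = 0}
    (hk : IsLimit (KernelFork.ofι k w)) {P : B.objs.FullSubcategory} (g : P ⟶ B.reflector.obj M)
    (hg : g ≫ B.reflector.map f = 0) :
    ∃ l : P ⟶ B.reflector.obj L, l ≫ B.reflector.map k = g :=
  let l := KernelFork.IsLimit.lift' ((KernelFork.ofι k w).mapIsLimit hk B.reflector) g hg
  ⟨l.1, l.2⟩

instance reflector_map_mono (f : M ⟶ N) [Mono f] : Mono (B.reflector.map f) := by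
  have hc : IsLimit (KernelFork.ofι (0 : quotRange (𝟙 M) ⟶ M) (zero_comp (f := f))) :=
    KernelFork.IsLimit.ofι _ _ (fun _ _ => 0)
    (fun g hg => by
      rw [zero_comp]
      exact (zero_of_comp_mono f hg).symm)
    (fun _ _ _ _ => (isZero_quotRange_id M).eq_of_tgt _ _)
  refine Preadditive.mono_of_cancel_zero _ fun g hg => ?_
  obtain ⟨l, hl⟩ := B.reflector_exists_lift hc g hg
  rw [← hl, Functor.map_zero, comp_zero]

variable {B} in
lemma torsionClass_iff : B.torsionClass M ↔ ∀ N, B.objs N → ∀ g : M ⟶ N, g = 0 := by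
  constructor
  · intro (h : IsZero _) N hN g
    obtain ⟨g, rfl⟩ := (B.adj.homEquiv M ⟨N, hN⟩).surjective g
    rw [h.eq_of_src g 0, Adjunction.homEquiv_unit, Functor.map_zero, comp_zero]
  · intro h
    refine (IsZero.iff_id_eq_zero _).2 ((B.adj.homEquiv M _).injective ?_)
    rw [h _ (B.reflector.obj M).property (B.adj.homEquiv M _ (𝟙 _)),
      h _ (B.reflector.obj M).property (B.adj.homEquiv M _ 0)]

lemma torsionClass_of_mono (f : M ⟶ N) [Mono f] (h : B.torsionClass N) : B.torsionClass M :=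
  IsZero.of_mono (B.reflector.map f) h

lemma torsionClass_of_epi (f : M ⟶ N) [Epi f] (h : B.torsionClass M) : B.torsionClass N :=
  torsionClass_iff.2 fun P hP g => by
    rw [← cancel_epi f, torsionClass_iff.1 h P hP (f ≫ g), comp_zero]

theorem torsionClass_isHereditary : IsHereditaryTorsionClass B.torsionClass where
  quotients := ⟨fun f _ h => B.torsionClass_of_epi f h⟩
  subobjects := ⟨fun f _ h => B.torsionClass_of_mono f h⟩
  coproducts J := ⟨by
    rintro M ⟨p⟩
    refine torsionClass_iff.2 fun N hN g => p.isColimit.hom_ext fun j => ?_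
    rw [comp_zero]
    exact torsionClass_iff.1 (p.prop_diag_obj j) N hN _⟩
  extensions := ⟨fun {S} hS h₁ h₃ => torsionClass_iff.2 fun N hN g => by
    -- A map vanishing on the left term factors through the cokernel of `S.f`. By exactness this
    -- embeds in the right term, so it is torsion.
    have := hS.exact.hasHomology
    have h := S.rightHomologyData
    have : Mono h.g' := hS.exact.mono_g' h
    obtain ⟨l, hl⟩ := CokernelCofork.IsColimit.desc' h.hp g (torsionClass_iff.1 h₁ N hN _)
    rw [← hl, torsionClass_iff.1 (B.torsionClass_of_mono h.g' h₃) N hN l, comp_zero]⟩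

variable {B} in
lemma mem_idealsOf_torsionClass_iff {I : LeftIdeal X} : I ∈ idealsOf B.torsionClass X ↔
    ∀ N, B.objs N → ∀ x : N.obj.obj X, (∀ Y, ∀ f ∈ I.carrier Y, act N f x = 0) → x = 0 :=
  torsionClass_iff.trans
    (forall_congr' fun _ => forall_congr' fun _ => I.forall_quot_hom_eq_zero_iff)

lemma ann_mem_idealsOf_of_torsionClass (h : B.torsionClass M) (x : M.obj.obj X) :
    ann x ∈ idealsOf B.torsionClass X :=
  haveI := quotDesc_ann_mono x rfl
  B.torsionClass_of_mono ((ann x).quotDesc x fun _ _ hf => hf) h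

/-- `(I : h)` is the annihilator of the class of `h` in the torsion module `Hom(X, -) / I`. -/
lemma colon_mem_idealsOf {I : LeftIdeal X} (h : X ⟶ Y) (hI : I ∈ idealsOf B.torsionClass X) :
    I.colon h ∈ idealsOf B.torsionClass Y := by
  convert B.ann_mem_idealsOf_of_torsionClass hI (appHom I.toQuot Y (homElement h))
  ext Z f
  rw [mem_ann, ← appHom_act, act_homElement, appHom_toQuot_eq_zero_iff, mem_colon]

lemma mem_idealsOf_of_colon {I J : LeftIdeal X} (hJ : J ∈ idealsOf B.torsionClass X)
    (h : ∀ (Y : C) (f : X ⟶ Y), f ∈ J.carrier Y → I.colon f ∈ idealsOf B.torsionClass Y) :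
    I ∈ idealsOf B.torsionClass X :=
  mem_idealsOf_torsionClass_iff.2 fun N hN x hx =>
    mem_idealsOf_torsionClass_iff.1 hJ N hN x fun Y f hf =>
      mem_idealsOf_torsionClass_iff.1 (h Y f hf) N hN _ fun Z g hg => by
        rw [← act_comp]
        exact hx Z _ hg

lemma mem_idealsOf_of_le {I J : LeftIdeal X} (hI : I ∈ idealsOf B.torsionClass X) (h : I ≤ J) :
    J ∈ idealsOf B.torsionClass X :=
  mem_idealsOf_torsionClass_iff.2 fun N hN x hx =>
    mem_idealsOf_torsionClass_iff.1 hI N hN x fun Y f hf => hx Y f (h Y hf)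

/-- The Gabriel filter attached to a Giraud subcategory. -/
def gabrielFilter : LeftGabrielFilter C where
  ideals := idealsOf B.torsionClass
  nonempty X := ⟨⊤, mem_idealsOf_torsionClass_iff.2 fun N _ x hx => by
    simpa using hx X (𝟙 X) trivial⟩
  up_closed := B.mem_idealsOf_of_le
  -- Intersections follow from transitivity: for `f` in `J`, the ideal `(I ⊓ J : f)` contains `(I :
  -- f)`.
  inter_mem {_ I J} hI hJ := B.mem_idealsOf_of_colon hJ fun Y f hf =>
    B.mem_idealsOf_of_le (B.colon_mem_idealsOf f hI) fun Z g hg => ⟨hg, J.comp_mem g hf⟩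
  colon_mem h hI := B.colon_mem_idealsOf h hI
  trans_mem := B.mem_idealsOf_of_colon

/-- `I` is the kernel of the projection to a torsion module, so its reflection is the kernel of a
map to zero. -/
lemma isIso_reflector_map_incl {I : LeftIdeal X} (hI : I ∈ idealsOf B.torsionClass X) :
    IsIso (B.reflector.map I.incl) := by
  have hinj : ∀ Y, Function.Injective (appHom I.incl Y) := fun Y => Subtype.val_injective
  have : Mono I.incl := mono_of_injective _ hinj
  have hc : IsLimit (KernelFork.ofι I.incl I.incl_toQuot) :=
    KernelFork.IsLimit.ofι' _ _ fun g hg => by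
    have h := exists_lift_of_injective I.incl hinj g fun Y y =>
      ⟨I.element (appHom g Y y) ((I.appHom_toQuot_eq_zero_iff _).1
        (congrArg (fun g => appHom g Y y) hg)), rfl⟩
    exact ⟨h.choose, h.choose_spec⟩
  obtain ⟨l, hl⟩ := B.reflector_exists_lift hc (𝟙 _) (IsZero.eq_of_tgt hI _ _)
  refine ⟨l, ?_, hl⟩
  rw [← cancel_mono (B.reflector.map I.incl), Category.assoc, hl, Category.comp_id,
    Category.id_comp]

/-- The adjunction turns restriction along `I.incl` into precomposition with its reflection, an
isomorphism. -/
lemma objs_le_closedModules : B.objs ≤ B.gabrielFilter.closedModules := by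
  intro N hN X I hI
  have := B.isIso_reflector_map_incl hI
  have h : (fun g : homMod X ⟶ N => I.incl ≫ g) = B.adj.homEquiv I.toMod ⟨N, hN⟩ ∘
      (fun g => B.reflector.map I.incl ≫ g) ∘ (B.adj.homEquiv (homMod X) ⟨N, hN⟩).symm := by
    funext g
    simp only [Function.comp_apply, Adjunction.homEquiv_naturality_left, Equiv.apply_symm_apply]
  rw [h]
  exact (Equiv.bijective _).comp
    ((asIso (B.reflector.map I.incl)).homFromEquiv.symm.bijective.comp (Equiv.bijective _))

/-- The unit of the reflection is a local isomorphism for the attached Gabriel filter. -/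
lemma unit_isLocalIso (M : LMod C) : B.gabrielFilter.IsLocalIso (B.adj.unit.app M) where
  ker X x hx := by
    have := quotDesc_ann_mono x rfl
    let j : (ann x).quot ⟶ M := (ann x).quotDesc x fun _ _ hf => hf
    have hj : j ≫ B.adj.unit.app M = 0 := hom_ext_elements fun Y y => by
      obtain ⟨y, rfl⟩ := (ann x).toQuot_surjective Y y
      obtain ⟨f, rfl⟩ := homElement_surjective y
      change appHom _ Y (act M f x) = 0
      rw [appHom_act, hx, map_zero]
    -- The reflector inverts the unit, since the inclusion is fully faithful. So `j` reflects to a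
    -- map that is both mono and zero.
    have h0 : B.reflector.map j = 0 := by
      rw [← cancel_mono (B.reflector.map (B.adj.unit.app M)), ← Functor.map_comp, hj,
        Functor.map_zero, zero_comp]
    exact IsZero.of_mono_eq_zero (B.reflector.map j) h0
  coker X y := by
    -- A map from the cokernel to an object of `B` gives a map out of the reflection that vanishes
    -- on the unit, hence is zero. The conductor of `y` is then the annihilator of its class in a
    -- torsion module.
    have h : B.torsionClass (quotRange (B.adj.unit.app M)) := torsionClass_iff.2 fun N hN g => by
      have h0 : (ObjectProperty.homMk (quotRangeMk (B.adj.unit.app M) ≫ g) :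
          B.reflector.obj M ⟶ ⟨N, hN⟩) = 0 := (B.adj.homEquiv _ _).injective (by
        simp only [Adjunction.homEquiv_unit, Functor.map_zero, comp_zero]
        change B.adj.unit.app M ≫ quotRangeMk _ ≫ g = 0
        rw [← Category.assoc, comp_quotRangeMk, zero_comp])
      refine hom_ext_elements fun Y z => ?_
      obtain ⟨z, rfl⟩ := quotRangeMk_surjective _ Y z
      exact congrArg (fun t : B.reflector.obj M ⟶ ⟨N, hN⟩ => appHom t.hom Y z) h0
    convert! B.ann_mem_idealsOf_of_torsionClass h
      (appHom (quotRangeMk (B.adj.unit.app M)) X y) using 1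
    ext Y f
    rw [mem_ann, ← appHom_act, quotRangeMk_eq_zero_iff, mem_conductor]

lemma isIso_unit_of_closed (hM : B.gabrielFilter.closedModules M) : IsIso (B.adj.unit.app M) :=
  isIso_of_bijective _ ((B.unit_isLocalIso M).bijective hM
    (B.gabrielFilter.closedModules_iff.1
      (B.objs_le_closedModules _ (B.reflector.obj M).property)).1)

variable {B B'} in
lemma torsionClass_le_of_equiv (h : B ≈ B') : B'.torsionClass ≤ B.torsionClass := by
  obtain ⟨e, ⟨i⟩⟩ := h
  refine fun M hM => torsionClass_iff.2 fun N hN g => ?_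
  rw [← cancel_mono (i.inv.app ⟨N, hN⟩), zero_comp]
  exact torsionClass_iff.1 hM _ (e.functor.obj ⟨N, hN⟩).property _

variable {B B'} in
lemma gabrielFilter_eq_of_equiv (h : B ≈ B') : B.gabrielFilter = B'.gabrielFilter :=
  LeftGabrielFilter.ext (congrArg idealsOf
    (le_antisymm (torsionClass_le_of_equiv (Setoid.symm h)) (torsionClass_le_of_equiv h)))

variable {B B'} in
lemma equiv_of_le (h : B.objs ≤ B'.objs) (h' : B'.objs ≤ B.objs.isoClosure) : B ≈ B' := by
  have : (ObjectProperty.ιOfLE h).EssSurj := ⟨fun M => by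
    obtain ⟨N, hN, ⟨i⟩⟩ := h' _ M.property
    exact ⟨⟨N, hN⟩, ⟨ObjectProperty.isoMk _ i.symm⟩⟩⟩
  have : (ObjectProperty.ιOfLE h).IsEquivalence := {}
  exact ⟨(ObjectProperty.ιOfLE h).asEquivalence, ⟨Iso.refl _⟩⟩

/-! ### The two constructions are mutually inverse. -/

variable [EssentiallySmall.{v} C]

/-- The Giraud subcategory of closed modules. -/
def ofFilter (F : LeftGabrielFilter C) : GiraudSubcategory (LMod C) :=
  ⟨F.closedModules, F.closedModules_isGiraud⟩

lemma gabrielFilter_ofFilter (F : LeftGabrielFilter C) : (ofFilter F).gabrielFilter = F := by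
  refine LeftGabrielFilter.ext (funext fun X => Set.ext fun I => ?_)
  refine ⟨fun hI => ?_, fun hI => mem_idealsOf_torsionClass_iff.2 fun N hN =>
    (F.closedModules_iff.1 hN).1 I hI⟩
  -- The localization of `Hom(X, -) / I` is closed, so `toLoc` vanishes on the quotient; the class
  -- of `𝟙 X` is then torsion, and its annihilator is `I`.
  have h0 := torsionClass_iff.1 hI (F.loc I.quot) (LeftGabrielFilter.loc_closed _) (F.toLoc _)
  have h := (LeftGabrielFilter.toLoc_eq_zero_iff (F := F)
    (appHom I.toQuot X (homElement (𝟙 X)))).1 (by rw [h0, appHom_zero])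
  convert h
  ext Y f
  rw [mem_ann, ← appHom_homMod, appHom_toQuot_eq_zero_iff]

lemma ofFilter_gabrielFilter : ofFilter B.gabrielFilter ≈ B :=
  Setoid.symm (equiv_of_le B.objs_le_closedModules fun M hM =>
    haveI := B.isIso_unit_of_closed hM
    ⟨_, (B.reflector.obj M).property, ⟨asIso (B.adj.unit.app M)⟩⟩)

/-- Gabriel filters correspond to equivalence classes of Giraud subcategories. -/
def filterEquiv (C : Type u) [Category.{v} C] [Preadditive C] [EssentiallySmall.{v} C] :
    LeftGabrielFilter C ≃ Quotient (GiraudSubcategory.setoid (LMod C)) where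
  toFun F := ⟦ofFilter F⟧
  invFun := Quotient.lift gabrielFilter fun _ _ => gabrielFilter_eq_of_equiv
  left_inv := gabrielFilter_ofFilter
  right_inv := by
    rintro ⟨B⟩
    exact Quotient.sound B.ofFilter_gabrielFilter

end GiraudSubcategory

end GabrielLoc

end

theorem theorem4 {C : Type u} [Category.{v} C] [Preadditive C] [EssentiallySmall.{v} C] :
    ∃ e : GabrielLoc.LeftGabrielFilter C ≃
        Quotient (GabrielLoc.GiraudSubcategory.setoid (GabrielLoc.LMod C)),
      (∀ F : GabrielLoc.LeftGabrielFilter C,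
        ∃ h : GabrielLoc.IsGiraud F.closedModules, e F = ⟦⟨F.closedModules, h⟩⟧) ∧
      (∀ B : GabrielLoc.GiraudSubcategory (GabrielLoc.LMod C),
        GabrielLoc.IsHereditaryTorsionClass B.torsionClass ∧
        (e.symm ⟦B⟧).ideals = GabrielLoc.idealsOf B.torsionClass) :=
  ⟨GabrielLoc.GiraudSubcategory.filterEquiv C, fun F => ⟨F.closedModules_isGiraud, rfl⟩,
    fun B => ⟨B.torsionClass_isHereditary, rfl⟩⟩
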